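/- For integers $k,m\ge 1$ let (with natural logarithms and the convention $0\log 0=0$) \[h_{k,m}(t):=-kt\log t-(1-kt)\log(1-kt)+(1-kt)\log m\] and \begin{align*} g_{k,m}(x,y):={}&-(1-kx)(1-ky)\log\big((1-kx)(1-ky)\big)\\ &-\Big(x+y+\big(\tfrac{k(k-1)}{2}-1\big)xy\Big)\log\Big(x+y+\big(\tfrac{k(k-1)}{2}-1\big)xy\Big)\\ &-\sum_{j=1}^{k-1}\big(x+y-(2k-j+1)xy\big)\log\big(x+y-(2k-j+1)xy\big)+(1-kx)(1-ky)\log m . \end{align*} For $\phi\in[0,1]$ let $\mathcal M_\phi$ be the set of Borel probability measures $\mu$ on $[0,1]$ with $\mathbb E_{x\sim\mu}[x]=\phi$, and for $\mu\in\mathcal M_\phi$ put \[F_{k,m}(\mu):=\mathbb E_{(x,y)\sim\mu\times\mu}\Big[g_{k,m}\big(\tfrac xk,\tfrac yk\big)\Big]-\mathbb E_{x\sim\mu}\Big[h_{k,m}\big(\tfrac xk\big)\Big].\] Let $k\ge 5$ and $1\le m\le\sqrt k$ be integers. Then for every real $0<\phi<\tfrac12$ and every $x\in[0,\phi]$, the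 measure $\frac{\phi-x}{1-x}\,\delta_1+\frac{1-\phi}{1-x}\,\delta_x$ belongs to $\mathcal M_\phi$ and \[F_{k,m}\Big(\frac{\phi-x}{1-x}\,\delta_1+\frac{1-\phi}{1-x}\,\delta_x\Big)>0.\] -/

import Mathlib

open MeasureTheory

noncomputable section

namespace EntropyFunctional

/-- The function `h_{k,m}(t) = -kt log t - (1-kt) log (1-kt) + (1-kt) log m`,
with the usual convention `0 log 0 = 0`. -/
def h (k m : ℕ) (t : ℝ) : ℝ :=
  -(k * t * Real.log t) - (1 - k * t) * Real.log (1 - k * t) + (1 - k * t) * Real.log m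

/-- The function `g_{k,m}(x,y)`, with the usual convention `0 log 0 = 0`. -/
def g (k m : ℕ) (x y : ℝ) : ℝ :=
  -((1 - k * x) * (1 - k * y) * Real.log ((1 - k * x) * (1 - k * y)))
    - (x + y + ((k : ℝ) * (k - 1) / 2 - 1) * (x * y))
        * Real.log (x + y + ((k : ℝ) * (k - 1) / 2 - 1) * (x * y))
    - ∑ j ∈ Finset.Icc 1 (k - 1),
        (x + y - (2 * (k : ℝ) - j + 1) * (x * y))
          * Real.log (x + y - (2 * (k : ℝ) - j + 1) * (x * y))
    + (1 - k * x) * (1 - k * y) * Real.log m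

/-- The space `M_φ` of probability distributions on `[0,1]` with expectation `φ`
(as Borel measures on the line that are carried by `[0,1]`). -/
def M (φ : ℝ) : Set (Measure ℝ) :=
  {μ | IsProbabilityMeasure μ ∧ μ (Set.Icc 0 1)ᶜ = 0 ∧ ∫ x, x ∂μ = φ}

/-- The functional
`F_{k,m}(μ) = E_{(x,y) ∼ μ × μ} [g_{k,m}(x/k, y/k)] - E_{x ∼ μ} [h_{k,m}(x/k)]`. -/
def F (k m : ℕ) (μ : Measure ℝ) : ℝ :=
  ∫ p, g k m (p.1 / k) (p.2 / k) ∂(μ.prod μ) - ∫ x, h k m (x / k) ∂μ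

/-- The two-point measure `((φ-x)/(1-x)) δ_1 + ((1-φ)/(1-x)) δ_x`. -/
def typeIII (φ x : ℝ) : Measure ℝ :=
  ENNReal.ofReal ((φ - x) / (1 - x)) • Measure.dirac 1
    + ENNReal.ofReal ((1 - φ) / (1 - x)) • Measure.dirac x

end EntropyFunctional

end

namespace EntropyFunctional

open Real MeasureTheory

/-! Let `p`, `q` be the weights at `1` and `x`. Then `F` is a quadratic form in `(p, q)`, with the
linear part homogenised by `p + q = 1`. Since `q(1-2x) - p = 1 - 2φ`, it splits around mean `1/2`:
`(1-2x) F = p q E + (1-2φ) (p (1-2x) (log k - g(1,1)) + q (g(x,x) - h(x)))`, where `g`, `h` have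
arguments scaled by `1/k` and `E` is a positive multiple of `F` at the measure on `{1, x}` of mean
`1/2`. The signs come from `quadratic_at_half_pos`, `g_one_one_le` and `g_diag_sub_h_lower`.

For these, put `u = 1/k`: the sums over `j` become Riemann sums of `negMulLog` with mesh `u`.
Polynomial minorants of `negMulLog` and power-sum formulas leave polynomial inequalities in `x` and
`u`, which for `k ≥ 6` are certified in the Bernstein basis of `[0,1/2] × [0,1/6]`. The case `k = 5`
is separate and uses `m ≤ 2`, sharper than `m ≤ √5`. -/

/-! ### Polynomial bounds for `log` and `negMulLog` -/

/-- The difference of the two sides has derivative `(t-1)^3 / t`, so its minimum is the value `0` at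
`t = 1`. -/
theorem log_le_cubic {y : ℝ} (hy : 0 < y) :
    log y ≤ (y - 1) - (y - 1) ^ 2 / 2 + (y - 1) ^ 3 / 3 := by
  have hd : ∀ z : ℝ, 0 < z → HasDerivAt
      (fun t : ℝ => (t - 1) - (t - 1) ^ 2 / 2 + (t - 1) ^ 3 / 3 - log t) ((z - 1) ^ 3 / z) z := by
    intro z hz
    have h1 : HasDerivAt (fun t : ℝ => t - 1) 1 z := (hasDerivAt_id z).sub_const 1
    refine HasDerivAt.congr_deriv (((h1.sub ((h1.pow 2).div_const 2)).add
      ((h1.pow 3).div_const 3)).sub (hasDerivAt_log hz.ne')) ?_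
    rw [eq_div_iff hz.ne', sub_mul, inv_mul_cancel₀ hz.ne']
    push_cast
    ring
  have hc : ∀ s ⊆ Set.Ioi (0 : ℝ), ContinuousOn
      (fun t : ℝ => (t - 1) - (t - 1) ^ 2 / 2 + (t - 1) ^ 3 / 3 - log t) s :=
    fun s hs t ht => (hd t (hs ht)).continuousAt.continuousWithinAt
  rcases le_total y 1 with h | h
  · have hanti : AntitoneOn
        (fun t : ℝ => (t - 1) - (t - 1) ^ 2 / 2 + (t - 1) ^ 3 / 3 - log t) (Set.Icc y 1) := by
      refine antitoneOn_of_deriv_nonpos (convex_Icc y 1)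
        (hc _ fun t ht => hy.trans_le ht.1) ?_ ?_
      · intro t ht
        rw [interior_Icc] at ht
        exact (hd t (hy.trans ht.1)).differentiableAt.differentiableWithinAt
      · intro t ht
        rw [interior_Icc] at ht
        rw [(hd t (hy.trans ht.1)).deriv]
        exact div_nonpos_of_nonpos_of_nonneg
          (Odd.pow_nonpos (by decide) (by linarith [ht.2])) (hy.trans ht.1).le
    have := hanti (Set.left_mem_Icc.2 h) (Set.right_mem_Icc.2 h) h
    norm_num at this
    linarith
  · have hmono : MonotoneOn
        (fun t : ℝ => (t - 1) - (t - 1) ^ 2 / 2 + (t - 1) ^ 3 / 3 - log t) (Set.Icc 1 y) := by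
      have hp : ∀ t ∈ Set.Icc 1 y, (0 : ℝ) < t := fun t ht => one_pos.trans_le ht.1
      refine monotoneOn_of_deriv_nonneg (convex_Icc 1 y) (hc _ hp) ?_ ?_
      · intro t ht
        exact (hd t (hp t (interior_subset ht))).differentiableAt.differentiableWithinAt
      · intro t ht
        have ht' := interior_subset ht
        rw [(hd t (hp t ht')).deriv]
        exact div_nonneg (pow_nonneg (by linarith [ht'.1]) 3) (hp t ht').le
    have := hmono (Set.left_mem_Icc.2 h) (Set.right_mem_Icc.2 h) h
    norm_num at this
    linarith

theorem mul_sub_div_le_negMulLog {s t : ℝ} (hs : 0 < s) (ht : 0 ≤ t) :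
    t * (1 - log s - t / s) ≤ negMulLog t := by
  rcases ht.eq_or_lt with rfl | ht
  · simp
  have h := log_le_sub_one_of_pos (div_pos ht hs)
  rw [log_div ht.ne' hs.ne'] at h
  rw [negMulLog, neg_mul, ← mul_neg]
  exact mul_le_mul_of_nonneg_left (by linarith) ht.le

theorem cubic_le_negMulLog {s t : ℝ} (hs : 0 < s) (ht : 0 ≤ t) :
    t * (-log s - ((t / s - 1) - (t / s - 1) ^ 2 / 2 + (t / s - 1) ^ 3 / 3)) ≤ negMulLog t := by
  rcases ht.eq_or_lt with rfl | ht
  · simp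
  have h := log_le_cubic (div_pos ht hs)
  rw [log_div ht.ne' hs.ne'] at h
  rw [negMulLog, neg_mul, ← mul_neg]
  exact mul_le_mul_of_nonneg_left (by linarith) ht.le

theorem negMulLog_one_sub_ge {y : ℝ} (hy0 : 0 ≤ y) (hy1 : y ≤ 1) :
    (1 - y) * (y + y ^ 2 / 2) ≤ negMulLog (1 - y) := by
  refine le_trans ?_ (cubic_le_negMulLog one_pos (sub_nonneg.2 hy1))
  refine mul_le_mul_of_nonneg_left ?_ (sub_nonneg.2 hy1)
  have := pow_nonneg hy0 3
  simp only [log_one, div_one]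
  nlinarith

theorem negMulLog_ge_of_le_half {x : ℝ} (hx0 : 0 ≤ x) (hx : x ≤ 1 / 2) :
    x * (log 2 + (1 - 2 * x) + (1 - 2 * x) ^ 2 / 2) ≤ negMulLog x := by
  refine le_trans ?_ (cubic_le_negMulLog (s := 1 / 2) (by norm_num) hx0)
  refine mul_le_mul_of_nonneg_left ?_ hx0
  have := pow_nonneg (show 0 ≤ 1 - 2 * x by linarith) 3
  have h2 : log (1 / 2 : ℝ) = -log 2 := by rw [one_div, log_inv]
  rw [h2]
  nlinarith

/-- This is `log c ≤ sinh (log c) = (c - 1/c) / 2`, multiplied by `-c`. -/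
theorem half_one_sub_sq_le_negMulLog {c : ℝ} (hc : 1 ≤ c) : (1 - c ^ 2) / 2 ≤ negMulLog c := by
  have hc0 : 0 < c := by linarith
  have h := self_le_sinh_iff.2 (log_nonneg hc)
  rw [sinh_eq, exp_neg, exp_log hc0] at h
  have h2 := mul_le_mul_of_nonneg_left h hc0.le
  have h3 : c * ((c - c⁻¹) / 2) = (c ^ 2 - 1) / 2 := by field_simp
  rw [negMulLog]
  linarith

theorem negMulLog_le_tangent {s t : ℝ} (hs : 0 < s) (ht : 0 ≤ t) :
    negMulLog t ≤ s - t * (1 + log s) := by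
  rcases ht.eq_or_lt with rfl | ht
  · simpa using hs.le
  have h := mul_le_mul_of_nonneg_left (log_le_sub_one_of_pos (div_pos hs ht)) ht.le
  rw [log_div hs.ne' ht.ne', mul_sub, mul_sub, mul_div_cancel₀ _ ht.ne'] at h
  rw [negMulLog]
  linarith

/-! ### Numerical logarithms -/

theorem log_five_bounds : 1.60908 < log 5 ∧ log 5 < 1.6096 := by
  have h1 := log_two_gt_d9
  have h2 := log_two_lt_d9
  -- `65/28` and `137/59` are close rational bounds for `log 5 / log 2`.
  have a : log ((5 : ℝ) ^ 28) > log ((2 : ℝ) ^ 65) := log_lt_log (by norm_num) (by norm_num)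
  have b : log ((5 : ℝ) ^ 59) < log ((2 : ℝ) ^ 137) := log_lt_log (by norm_num) (by norm_num)
  rw [log_pow, log_pow] at a b
  push_cast at a b
  constructor <;> linarith

theorem log_three_bounds : 1.09857 < log 3 ∧ log 3 < 1.09872 := by
  have h1 := log_two_gt_d9
  have h2 := log_two_lt_d9
  have a : log ((3 : ℝ) ^ 53) > log ((2 : ℝ) ^ 84) := log_lt_log (by norm_num) (by norm_num)
  have b : log ((3 : ℝ) ^ 94) < log ((2 : ℝ) ^ 149) := log_lt_log (by norm_num) (by norm_num)
  rw [log_pow, log_pow] at a b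
  push_cast at a b
  constructor <;> linarith

theorem log_six_bounds : 1.79 < log 6 ∧ log 6 < 1.792 := by
  have h : log (6 : ℝ) = log 2 + log 3 := by
    rw [← log_mul (by norm_num) (by norm_num)]; norm_num
  have h1 := log_two_gt_d9
  have h2 := log_two_lt_d9
  have h3 := log_three_bounds
  rw [h]
  constructor <;> linarith [h3.1, h3.2]

/-! ### Power sums and Riemann sums of `negMulLog` -/

theorem sum_range_pow_two (n : ℕ) :
    ∑ i ∈ Finset.range n, (i : ℝ) ^ 2 = n * (n - 1) * (2 * n - 1) / 6 := by
  induction n with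
  | zero => simp
  | succ n ih => rw [Finset.sum_range_succ, ih]; push_cast; ring

theorem sum_range_pow_one (n : ℕ) : ∑ i ∈ Finset.range n, (i : ℝ) = n * (n - 1) / 2 := by
  induction n with
  | zero => simp
  | succ n ih => rw [Finset.sum_range_succ, ih]; push_cast; ring

theorem sum_range_pow_three (n : ℕ) :
    ∑ i ∈ Finset.range n, (i : ℝ) ^ 3 = (n * (n - 1) / 2) ^ 2 := by
  induction n with
  | zero => simp
  | succ n ih => rw [Finset.sum_range_succ, ih]; push_cast; ring

theorem sum_range_pow_four (n : ℕ) :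
    ∑ i ∈ Finset.range n, (i : ℝ) ^ 4
      = n * (n - 1) * (2 * n - 1) * (3 * n ^ 2 - 3 * n - 1) / 30 := by
  induction n with
  | zero => simp
  | succ n ih => rw [Finset.sum_range_succ, ih]; push_cast; ring

/-- The Riemann sum `∑ a₀ + a₁ t + ⋯ + a₄ t⁴` over the points `t = i / k`, `i < k - 1`. -/
theorem riemann_sum_quartic {k : ℕ} (hk : 1 ≤ k) {u : ℝ} (hu : u = (k : ℝ)⁻¹)
    (a₀ a₁ a₂ a₃ a₄ : ℝ) :
    u * ∑ i ∈ Finset.range (k - 1), (a₀ + a₁ * (i * u) + a₂ * (i * u) ^ 2 + a₃ * (i * u) ^ 3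
        + a₄ * (i * u) ^ 4)
      = a₀ * (1 - u) + a₁ * ((1 - u) * (1 - 2 * u) / 2)
        + a₂ * ((1 - 2 * u) * (1 - u) * (2 - 3 * u) / 6)
        + a₃ * ((1 - u) ^ 2 * (1 - 2 * u) ^ 2 / 4)
        + a₄ * ((1 - 2 * u) * (1 - u) * (2 - 3 * u) * (3 * (1 - 2 * u) * (1 - u) - u ^ 2) / 30) := by
  have hk0 : (k : ℝ) ≠ 0 := by positivity
  simp only [mul_pow, Finset.sum_add_distrib, ← Finset.mul_sum, ← Finset.sum_mul,
    sum_range_pow_one, sum_range_pow_two, sum_range_pow_three, sum_range_pow_four,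
    Finset.sum_const, Finset.card_range, nsmul_eq_mul]
  rw [Nat.cast_sub hk, hu]
  push_cast
  field_simp
  ring

theorem sum_negMulLog_slope_ge {k : ℕ} (hk : 1 ≤ k) {u x : ℝ} (hu : u = (k : ℝ)⁻¹)
    (hx0 : 0 ≤ x) (hx : x ≤ 1 / 2) :
    ((1 - 4 * (1 - x) ^ 2) * (1 - u) - 4 * (1 - x) * x * ((1 - u) * (1 - 2 * u) / 2)
        - x ^ 2 * ((1 - 2 * u) * (1 - u) * (2 - 3 * u) / 6)) / 2
      ≤ u * ∑ i ∈ Finset.range (k - 1), negMulLog (2 - 2 * x + i * u * x) := by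
  have hu0 : 0 ≤ u := by rw [hu]; positivity
  have key := riemann_sum_quartic hk hu ((1 - 4 * (1 - x) ^ 2) / 2) (-(2 * (1 - x) * x))
    (-(x ^ 2 / 2)) 0 0
  refine le_trans (le_of_eq ?_) ((key.symm.le).trans
    (mul_le_mul_of_nonneg_left (Finset.sum_le_sum fun i _ => ?_) hu0))
  · ring
  · have h0 : 0 ≤ i * u * x := by positivity
    refine le_trans (le_of_eq ?_) (half_one_sub_sq_le_negMulLog (by linarith))
    ring

theorem sum_negMulLog_one_sub_ge {k : ℕ} (hk : 1 ≤ k) {u x : ℝ} (hu : u = (k : ℝ)⁻¹)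
    (hx0 : 0 ≤ x) (hx : x ≤ 1 / 2) :
    (x - x ^ 2 / 2 - x ^ 3 / 2) * (1 - u)
        + (-x + x ^ 2 + 3 / 2 * x ^ 3) * ((1 - u) * (1 - 2 * u) / 2)
        + (-(x ^ 2 / 2) - 3 / 2 * x ^ 3) * ((1 - 2 * u) * (1 - u) * (2 - 3 * u) / 6)
        + x ^ 3 / 2 * ((1 - u) ^ 2 * (1 - 2 * u) ^ 2 / 4)
      ≤ u * ∑ i ∈ Finset.range (k - 1), negMulLog (1 - x + i * u * x) := by
  have hu0 : 0 ≤ u := by rw [hu]; positivity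
  have hk0 : (k : ℝ) ≠ 0 := by positivity
  have key := riemann_sum_quartic hk hu (x - x ^ 2 / 2 - x ^ 3 / 2)
    (-x + x ^ 2 + 3 / 2 * x ^ 3) (-(x ^ 2 / 2) - 3 / 2 * x ^ 3) (x ^ 3 / 2) 0
  refine le_trans (le_of_eq ?_) ((key.symm.le).trans
    (mul_le_mul_of_nonneg_left (Finset.sum_le_sum fun i hi => ?_) hu0))
  · ring
  · have h0 : 0 ≤ i * u := by positivity
    have h1 : i * u ≤ 1 := by
      rw [hu, ← div_eq_mul_inv, div_le_one (by positivity)]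
      have := Finset.mem_range.1 hi
      exact_mod_cast (by omega : i ≤ k)
    have hy0 : 0 ≤ x * (1 - i * u) := mul_nonneg hx0 (by linarith)
    have hy1 : x * (1 - i * u) ≤ 1 := by nlinarith
    have h := negMulLog_one_sub_ge hy0 hy1
    rw [show 1 - x + i * u * x = 1 - x * (1 - i * u) by ring]
    refine le_trans (le_of_eq ?_) h
    ring

/-- The cubic bound for `log` centred at `2/5` gives a quartic minorant of `negMulLog`, which is
summed exactly. -/
theorem sum_negMulLog_riemann_ge {k : ℕ} (hk : 1 ≤ k) {u : ℝ} (hu : u = (k : ℝ)⁻¹) :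
    (0.9159 + 11 / 6) * ((1 - u) * (1 - 2 * u) / 2)
        - 15 / 2 * ((1 - 2 * u) * (1 - u) * (2 - 3 * u) / 6)
        + 75 / 8 * ((1 - u) ^ 2 * (1 - 2 * u) ^ 2 / 4)
        - 125 / 24 * ((1 - 2 * u) * (1 - u) * (2 - 3 * u)
          * (3 * (1 - 2 * u) * (1 - u) - u ^ 2) / 30)
      ≤ u * ∑ i ∈ Finset.range (k - 1), negMulLog (i * u) := by
  have hu0 : 0 ≤ u := by rw [hu]; positivity
  have key := riemann_sum_quartic hk hu 0 (0.9159 + 11 / 6) (-(15 / 2)) (75 / 8) (-(125 / 24))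
  refine le_trans (le_of_eq ?_) ((key.symm.le).trans
    (mul_le_mul_of_nonneg_left (Finset.sum_le_sum fun i _ => ?_) hu0))
  · ring
  · have h0 : 0 ≤ i * u := by positivity
    refine le_trans ?_ (cubic_le_negMulLog (s := 2 / 5) (by norm_num) h0)
    have hl : (0.9159 : ℝ) ≤ -log (2 / 5) := by
      rw [log_div (by norm_num) (by norm_num)]
      linarith [log_five_bounds.1, log_two_lt_d9]
    have := mul_le_mul_of_nonneg_left hl h0
    linarith

/-- A quadratic lower bound for the entropy term at the pair `(1, 1)`. -/
theorem diag_one_entropy_ge {k : ℕ} (hk : 5 ≤ k) {u : ℝ} (hu : u = (k : ℝ)⁻¹)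
    (hu5 : u ≤ 1 / 5) :
    (1 / 2 + 3 / 2 * u - u ^ 2) * (1.4054 - 3 / 2 * (1 / 2 + 3 / 2 * u - u ^ 2))
      ≤ negMulLog (1 / 2 + 3 / 2 * u - u ^ 2) := by
  have hu0 : 0 ≤ u := by rw [hu]; positivity
  have hB : 0 ≤ 1 / 2 + 3 / 2 * u - u ^ 2 := by nlinarith
  refine le_trans ?_ (mul_sub_div_le_negMulLog (s := 2 / 3) (by norm_num) hB)
  refine mul_le_mul_of_nonneg_left ?_ hB
  rw [log_div (by norm_num) (by norm_num)]
  linarith [log_three_bounds.1, log_two_lt_d9]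

theorem negMulLog_ge_quadratic {t : ℝ} (ht : 0 ≤ t) :
    t * (1.6931 - 2 * t) ≤ negMulLog t := by
  refine le_trans ?_ (mul_sub_div_le_negMulLog (s := 1 / 2) (by norm_num) ht)
  refine mul_le_mul_of_nonneg_left ?_ ht
  rw [log_div (by norm_num) (by norm_num), log_one]
  linarith [log_two_gt_d9]

theorem negMulLog_ge_quadratic' {t : ℝ} (ht : 0 ≤ t) :
    t * (1.7979 - 20 / 9 * t) ≤ negMulLog t := by
  refine le_trans ?_ (mul_sub_div_le_negMulLog (s := 9 / 20) (by norm_num) ht)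
  refine mul_le_mul_of_nonneg_left ?_ ht
  have h9 : log (9 : ℝ) = 2 * log 3 := by
    rw [show (9 : ℝ) = 3 ^ 2 by norm_num, log_pow]; norm_num
  have h20 : log (20 : ℝ) = 2 * log 2 + log 5 := by
    rw [show (20 : ℝ) = 2 ^ 2 * 5 by norm_num, log_mul (by norm_num) (by norm_num), log_pow]
    norm_num
  rw [log_div (by norm_num) (by norm_num), h9, h20]
  linarith [log_two_gt_d9, log_three_bounds.2, log_five_bounds.1]

/-! ### Polynomial positivity via Bernstein bases -/

theorem bernstein_nonneg {x u : ℝ} (hx0 : 0 ≤ x) (hx : x ≤ 1 / 2) (hu0 : 0 ≤ u) (hu : u ≤ 1 / 6)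
    (i j a b : ℕ) : 0 ≤ x ^ i * (1 / 2 - x) ^ j * (u ^ a * (1 / 6 - u) ^ b) :=
  mul_nonneg (mul_nonneg (pow_nonneg hx0 _) (pow_nonneg (by linarith) _))
    (mul_nonneg (pow_nonneg hu0 _) (pow_nonneg (by linarith) _))

theorem single_point_poly_pos {x u : ℝ} (hx0 : 0 ≤ x) (hx : x ≤ 1 / 2) (hu0 : 0 ≤ u)
    (hu : u ≤ 1 / 6) :
    0 < (1 - 2 * x) * (1 - x) + (1 - x) * (0.6931 + 1 - 2 * x)
      + ((1 - 4 * (1 - x) ^ 2) * (1 - u) - 4 * (1 - x) * x * ((1 - u) * (1 - 2 * u) / 2)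
        - x ^ 2 * ((1 - 2 * u) * (1 - u) * (2 - 3 * u) / 6)) / 2
      + (2 * u + (1 / 2 - u / 2 - u ^ 2) * x)
        * (1.6931 - 2 * (2 * u + (1 / 2 - u / 2 - u ^ 2) * x))
      + 1.79 * (1 / 2 - x) - (1 / 6 + 0.792 * u) * (2 - x * (1 / 2 + u)) := by
  have h := bernstein_nonneg hx0 hx hu0 hu
  linarith [h 0 2 0 4, h 0 2 1 3, h 0 2 2 2, h 0 2 3 1, h 0 2 4 0,
    h 1 1 0 4, h 1 1 1 3, h 1 1 2 2, h 1 1 3 1, h 1 1 4 0,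
    h 2 0 0 4, h 2 0 1 3, h 2 0 2 2, h 2 0 3 1, h 2 0 4 0]

theorem diag_one_poly_ge {u : ℝ} (hu0 : 0 ≤ u) (hu : u ≤ 1 / 6) :
    1 / 2 - 9 / 25 * u ≤
      (1 / 2 + 3 / 2 * u - u ^ 2) * (1.4054 - 3 / 2 * (1 / 2 + 3 / 2 * u - u ^ 2))
      + ((0.9159 + 11 / 6) * ((1 - u) * (1 - 2 * u) / 2)
        - 15 / 2 * ((1 - 2 * u) * (1 - u) * (2 - 3 * u) / 6)
        + 75 / 8 * ((1 - u) ^ 2 * (1 - 2 * u) ^ 2 / 4)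
        - 125 / 24 * ((1 - 2 * u) * (1 - u) * (2 - 3 * u)
          * (3 * (1 - 2 * u) * (1 - u) - u ^ 2) / 30)) := by
  have h := bernstein_nonneg le_rfl (by norm_num : (0 : ℝ) ≤ 1 / 2) hu0 hu 0 0
  linarith [h 0 5, h 1 4, h 2 3, h 3 2, h 4 1, h 5 0]

theorem half_mean_poly_pos {x u : ℝ} (hx0 : 0 ≤ x) (hx : x ≤ 1 / 2) (hu0 : 0 ≤ u)
    (hu : u ≤ 1 / 6) :
    0 < (1 - 2 * x) ^ 2 * (1 / 2 - 9 / 25 * u)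
      + 2 * (1 - 2 * x) * ((x - x ^ 2 / 2 - x ^ 3 / 2) * (1 - u)
        + (-x + x ^ 2 + 3 / 2 * x ^ 3) * ((1 - u) * (1 - 2 * u) / 2)
        + (-(x ^ 2 / 2) - 3 / 2 * x ^ 3) * ((1 - 2 * u) * (1 - u) * (2 - 3 * u) / 6)
        + x ^ 3 / 2 * ((1 - u) ^ 2 * (1 - 2 * u) ^ 2 / 4))
      + 4 * x * (1 - 2 * x) * (0.31 + 0.3 * u)
      + x * (((1 - 4 * (1 - x) ^ 2) * (1 - u) - 4 * (1 - x) * x * ((1 - u) * (1 - 2 * u) / 2)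
        - x ^ 2 * ((1 - 2 * u) * (1 - u) * (2 - 3 * u) / 6)) / 2
      + (2 * u + (1 / 2 - u / 2 - u ^ 2) * x)
        * (1.6931 - 2 * (2 * u + (1 / 2 - u / 2 - u ^ 2) * x)))
      + x ^ 2 * (0.6931 + (1 - 2 * x) + (1 - 2 * x) ^ 2 / 2)
      - (1 / 6 + 0.792 * u) * ((7 / 2 - u) * (1 - x) ^ 2 - 2 * (1 - 2 * x) ^ 2) := by
  have h := bernstein_nonneg hx0 hx hu0 hu
  -- The polynomial has degree 4 in `x`; the certificate uses the Bernstein basis of the elevated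
  -- degree 7.
  linarith [h 0 7 0 4, h 0 7 1 3, h 0 7 2 2, h 0 7 3 1, h 0 7 4 0,
    h 1 6 0 4, h 1 6 1 3, h 1 6 2 2, h 1 6 3 1, h 1 6 4 0,
    h 2 5 0 4, h 2 5 1 3, h 2 5 2 2, h 2 5 3 1, h 2 5 4 0,
    h 3 4 0 4, h 3 4 1 3, h 3 4 2 2, h 3 4 3 1, h 3 4 4 0,
    h 4 3 0 4, h 4 3 1 3, h 4 3 2 2, h 4 3 3 1, h 4 3 4 0,
    h 5 2 0 4, h 5 2 1 3, h 5 2 2 2, h 5 2 3 1, h 5 2 4 0,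
    h 6 1 0 4, h 6 1 1 3, h 6 1 2 2, h 6 1 3 1, h 6 1 4 0,
    h 7 0 0 4, h 7 0 1 3, h 7 0 2 2, h 7 0 3 1, h 7 0 4 0]

/-! ### The two analytic positivity estimates -/

/-- Tangent line to the concave function `negMulLog` at `u = 1/6`, with slope `log 6 - 1 < 0.792`.
-/
theorem mul_log_le_of_six_le {k : ℕ} (hk : 6 ≤ k) {u : ℝ} (hu : u = (k : ℝ)⁻¹) :
    u * log k ≤ 1 / 6 + 0.792 * u := by
  have hu0 : 0 ≤ u := by rw [hu]; positivity
  have h := negMulLog_le_tangent (s := 1 / 6) (by norm_num) hu0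
  have h1 : negMulLog u = u * log k := by rw [hu, negMulLog, log_inv]; ring
  rw [h1, log_div one_ne_zero (by norm_num), log_one] at h
  nlinarith [log_six_bounds.2]

theorem log_six_le_log {k : ℕ} (hk : 6 ≤ k) : 1.79 ≤ log k :=
  log_six_bounds.1.le.trans (log_le_log (by norm_num) (by exact_mod_cast hk))

/-- Positivity of the functional at a single point mass, after dividing by the point. -/
theorem single_point_pos {k : ℕ} (hk : 5 ≤ k) {u x ℓ : ℝ} (hu : u = (k : ℝ)⁻¹)
    (hx0 : 0 ≤ x) (hx : x ≤ 1 / 2) (hl : ℓ ≤ log k / 2) (hl5 : k = 5 → ℓ ≤ log 2) :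
    0 < (1 - 2 * x) * (1 - x) + (1 - x) * (log 2 + 1 - 2 * x)
      + (negMulLog (2 * u + (1 / 2 - u / 2 - u ^ 2) * x)
        + u * ∑ i ∈ Finset.range (k - 1), negMulLog (2 - 2 * x + i * u * x))
      + log k * (1 - x - (2 * u + (1 / 2 - u / 2 - u ^ 2) * x)) - (1 - x) * ℓ := by
  have hu0 : 0 ≤ u := by rw [hu]; positivity
  have hsum := sum_negMulLog_slope_ge (by omega) hu hx0 hx
  rcases hk.eq_or_lt with rfl | hk
  · have hu5 : u = 1 / 5 := by rw [hu]; norm_num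
    have hb := negMulLog_ge_quadratic (t := 2 * u + (1 / 2 - u / 2 - u ^ 2) * x)
      (by rw [hu5]; nlinarith)
    have hL := log_five_bounds
    have h2 := log_two_lt_d9
    have h2' := log_two_gt_d9
    have h3 : (1 - x) * ℓ ≤ (1 - x) * log 2 :=
      mul_le_mul_of_nonneg_left (hl5 rfl) (by linarith)
    have h4 := mul_le_mul_of_nonneg_right hL.1.le (show 0 ≤ 1 / 2 - x by linarith)
    have h5 := mul_le_mul_of_nonneg_right hL.2.le hx0
    push_cast
    generalize u * ∑ i ∈ Finset.range (5 - 1), negMulLog (2 - 2 * x + i * u * x) = s at *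
    generalize negMulLog (2 * u + (1 / 2 - u / 2 - u ^ 2) * x) = t at *
    subst hu5
    linarith [mul_nonneg hx0 hx0, mul_nonneg hx0 (sub_nonneg.2 hx),
      mul_nonneg (sub_nonneg.2 hx) (sub_nonneg.2 hx)]
  · have hu6 : u ≤ 1 / 6 := by
      rw [hu, one_div]
      exact inv_anti₀ (by norm_num) (by exact_mod_cast hk)
    have hb := negMulLog_ge_quadratic (t := 2 * u + (1 / 2 - u / 2 - u ^ 2) * x)
      (by have : 0 ≤ 1 / 2 - u / 2 - u ^ 2 := by nlinarith
          positivity)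
    have h3 : (1 - x) * ℓ ≤ (1 - x) * (log k / 2) :=
      mul_le_mul_of_nonneg_left hl (by linarith)
    -- With `ℓ` replaced by `log k / 2`, the logarithmic part is `log k * (1/2 - x) - u * log k * (2
    -- - x * (1/2 + u))`.
    have h4 := mul_le_mul_of_nonneg_right (log_six_le_log hk) (show 0 ≤ 1 / 2 - x by linarith)
    have h5 := mul_le_mul_of_nonneg_right (mul_log_le_of_six_le hk hu)
      (show 0 ≤ 2 - x * (1 / 2 + u) by nlinarith)
    have h6 := mul_le_mul_of_nonneg_left (show (0.6931 : ℝ) ≤ log 2 by linarith [log_two_gt_d9])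
      (show 0 ≤ 1 - x by linarith)
    have := single_point_poly_pos hx0 hx hu0 hu6
    linarith

/-- The chord over `[0, 1/2]`. With `a = u` it keeps the exact endpoint value `u * log k`, which
offsets part of the negative `log k` term. -/
theorem negMulLog_affine_ge {a b x : ℝ} (ha : 0 ≤ a) (hb : 0 ≤ a + b / 2)
    (hx0 : 0 ≤ x) (hx : x ≤ 1 / 2) :
    (1 - 2 * x) * negMulLog a + 2 * x * negMulLog (a + b / 2) ≤ negMulLog (a + b * x) := by
  have h := concaveOn_negMulLog.2 ha hb (show 0 ≤ 1 - 2 * x by linarith)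
    (show 0 ≤ 2 * x by linarith) (by ring)
  simp only [smul_eq_mul] at h
  rwa [show (1 - 2 * x) * a + 2 * x * (a + b / 2) = a + b * x by ring] at h

/-- Positivity of the functional at two-point measures of mean `1/2`, after rescaling. -/
theorem half_mean_pos {k : ℕ} (hk : 5 ≤ k) {u x ℓ : ℝ} (hu : u = (k : ℝ)⁻¹)
    (hx0 : 0 ≤ x) (hx : x ≤ 1 / 2) (hl : ℓ ≤ log k / 2) (hl5 : k = 5 → ℓ ≤ log 2) :
    0 < (1 - 2 * x) ^ 2 * (negMulLog (1 / 2 + 3 / 2 * u - u ^ 2)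
        + u * ∑ i ∈ Finset.range (k - 1), negMulLog (i * u))
      + 2 * (1 - 2 * x) * (negMulLog (u + (1 / 2 + u / 2 - u ^ 2) * x)
        + u * ∑ i ∈ Finset.range (k - 1), negMulLog (1 - x + i * u * x))
      + x * (negMulLog (2 * u + (1 / 2 - u / 2 - u ^ 2) * x)
        + u * ∑ i ∈ Finset.range (k - 1), negMulLog (2 - 2 * x + i * u * x))
      + x * negMulLog x + (1 - x) ^ 2 * (log k * (1 / 2 - 7 / 2 * u + u ^ 2) - ℓ) := by
  have hu0 : 0 ≤ u := by rw [hu]; positivity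
  have hu5 : u ≤ 1 / 5 := by
    rw [hu, one_div]
    exact inv_anti₀ (by norm_num) (by exact_mod_cast hk)
  have hr : 0 ≤ 1 - 2 * x := by linarith
  have hs1 := mul_le_mul_of_nonneg_left (sum_negMulLog_slope_ge (by omega) hu hx0 hx) hx0
  have hs2 := mul_le_mul_of_nonneg_left (sum_negMulLog_one_sub_ge (by omega) hu hx0 hx) hr
  have hs3 := mul_le_mul_of_nonneg_left
    (add_le_add (diag_one_entropy_ge hk hu hu5) (sum_negMulLog_riemann_ge (by omega) hu))
    (sq_nonneg (1 - 2 * x))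
  have hw : 0 ≤ 1 / 2 - u / 2 - u ^ 2 := by nlinarith
  have hb := mul_le_mul_of_nonneg_left (negMulLog_ge_quadratic
    (t := 2 * u + (1 / 2 - u / 2 - u ^ 2) * x) (by positivity)) hx0
  have hx2 := mul_le_mul_of_nonneg_left (negMulLog_ge_of_le_half hx0 hx) hx0
  have hlog2 := mul_le_mul_of_nonneg_left
    (show (0.6931 : ℝ) ≤ log 2 by linarith [log_two_gt_d9]) (mul_nonneg hx0 hx0)
  have hmid : 0 ≤ u + (1 / 2 + u / 2 - u ^ 2) / 2 := by nlinarith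
  have hc := mul_le_mul_of_nonneg_left (negMulLog_affine_ge hu0 hmid hx0 hx) hr
  have hq := mul_le_mul_of_nonneg_left (negMulLog_ge_quadratic' hmid) (mul_nonneg hx0 hr)
  have hηu : negMulLog u = u * log k := by rw [hu, negMulLog, log_inv]; ring
  rw [hηu] at hc
  have hl' := mul_le_mul_of_nonneg_left hl (sq_nonneg (1 - x))
  rcases hk.eq_or_lt with rfl | hk
  · have hu5 : u = 1 / 5 := by rw [hu]; norm_num
    have hL := log_five_bounds
    have h2 := log_two_lt_d9
    have h3 : (1 - x) ^ 2 * ℓ ≤ (1 - x) ^ 2 * 0.6932 :=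
      mul_le_mul_of_nonneg_left (by linarith [hl5 rfl]) (sq_nonneg _)
    have h4 := mul_le_mul_of_nonneg_right hL.1.le (sq_nonneg (1 - 2 * x))
    have h5 := mul_le_mul_of_nonneg_right hL.2.le (sq_nonneg (1 - x))
    have h : ∀ i j : ℕ, 0 ≤ x ^ i * (1 / 2 - x) ^ j := fun i j =>
      mul_nonneg (pow_nonneg hx0 _) (pow_nonneg (by linarith) _)
    push_cast at *
    generalize negMulLog (2 * u + (1 / 2 - u / 2 - u ^ 2) * x) = t₁ at *
    generalize negMulLog (u + (1 / 2 + u / 2 - u ^ 2) * x) = t₂ at *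
    generalize negMulLog (1 / 2 + 3 / 2 * u - u ^ 2) = t₃ at *
    generalize negMulLog (u + (1 / 2 + u / 2 - u ^ 2) / 2) = t₄ at *
    generalize u * ∑ i ∈ Finset.range (5 - 1), negMulLog (2 - 2 * x + i * u * x) = s₁ at *
    generalize u * ∑ i ∈ Finset.range (5 - 1), negMulLog (1 - x + i * u * x) = s₂ at *
    generalize u * ∑ i ∈ Finset.range (5 - 1), negMulLog (i * u) = s₃ at *
    clear hηu
    subst hu5
    linarith [h 0 4, h 1 3, h 2 2, h 3 1, h 4 0]
  · have hu6 : u ≤ 1 / 6 := by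
      rw [hu, one_div]
      exact inv_anti₀ (by norm_num) (by exact_mod_cast hk)
    have hs3' := mul_le_mul_of_nonneg_left (diag_one_poly_ge hu0 hu6) (sq_nonneg (1 - 2 * x))
    have hq' := mul_le_mul_of_nonneg_left
      (show 0.31 + 0.3 * u ≤ (u + (1 / 2 + u / 2 - u ^ 2) / 2)
        * (1.7979 - 20 / 9 * (u + (1 / 2 + u / 2 - u ^ 2) / 2)) by
        have h := bernstein_nonneg le_rfl (by norm_num : (0 : ℝ) ≤ 1 / 2) hu0 hu6 0 0
        linarith [h 0 4, h 1 3, h 2 2, h 3 1, h 4 0]) (mul_nonneg hx0 hr)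
    -- After `log k / 2` cancels against the bound on `ℓ`, the net coefficient of `-u * log k` must
    -- be nonnegative for the upper bound on `u * log k` to apply.
    have hsq : (1 - 2 * x) ^ 2 ≤ (1 - x) ^ 2 := pow_le_pow_left₀ hr (by linarith) 2
    have hsq' : 2 * (1 - x) ^ 2 ≤ (7 / 2 - u) * (1 - x) ^ 2 :=
      mul_le_mul_of_nonneg_right (by linarith) (sq_nonneg _)
    have h5 := mul_le_mul_of_nonneg_right (mul_log_le_of_six_le hk hu)
      (show 0 ≤ (7 / 2 - u) * (1 - x) ^ 2 - 2 * (1 - 2 * x) ^ 2 by linarith)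
    have hP := half_mean_poly_pos hx0 hx hu0 hu6
    have e1 := hs3'.trans hs3
    have e2 := hq'.trans hq
    linarith

/-! ### Rescaled formulas for `h`, `g` and the two-point functional -/

theorem h_div {k m : ℕ} (hk : 1 ≤ k) (x : ℝ) :
    h k m (x / k) = negMulLog x + negMulLog (1 - x) + x * log k + (1 - x) * log m := by
  have hk0 : (k : ℝ) ≠ 0 := by positivity
  rw [h, mul_div_cancel₀ x hk0]
  rcases eq_or_ne x 0 with rfl | hx
  · simp
  rw [log_div hx hk0, negMulLog, negMulLog]
  ring

theorem g_div {k m : ℕ} (hk : 1 ≤ k) {u : ℝ} (hu : u = (k : ℝ)⁻¹) (x y : ℝ) :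
    g k m (x / k) (y / k) = negMulLog ((1 - x) * (1 - y))
      + negMulLog ((x + y) * u + (1 / 2 - u / 2 - u ^ 2) * (x * y))
      + (∑ i ∈ Finset.range (k - 1), (x + y - 2 * (x * y) + i * u * (x * y))) * (u * log k)
      + u * ∑ i ∈ Finset.range (k - 1), negMulLog (x + y - 2 * (x * y) + i * u * (x * y))
      + (1 - x) * (1 - y) * log m := by
  have hk0 : (k : ℝ) ≠ 0 := by positivity
  have hηu : negMulLog u = u * log k := by rw [hu, negMulLog, log_inv]; ring
  have e1 : ∀ t : ℝ, (k : ℝ) * (t / k) = t := fun t => mul_div_cancel₀ t hk0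
  have e2 : x / k + y / k + ((k : ℝ) * (k - 1) / 2 - 1) * (x / k * (y / k))
      = (x + y) * u + (1 / 2 - u / 2 - u ^ 2) * (x * y) := by
    rw [hu]; field_simp
  have e3 : ∑ j ∈ Finset.Icc 1 (k - 1),
        (x / k + y / k - (2 * (k : ℝ) - j + 1) * (x / k * (y / k)))
          * Real.log (x / k + y / k - (2 * (k : ℝ) - j + 1) * (x / k * (y / k)))
      = - ((∑ i ∈ Finset.range (k - 1), (x + y - 2 * (x * y) + i * u * (x * y))) * (u * log k)
      + u * ∑ i ∈ Finset.range (k - 1), negMulLog (x + y - 2 * (x * y) + i * u * (x * y))) := by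
    rw [Finset.sum_mul, Finset.mul_sum, ← Finset.sum_add_distrib, ← Finset.sum_neg_distrib,
      -- Reindexing by `j = i + 1` turns the coefficient `2k - j + 1` into `2k - i`.
      show Finset.Icc 1 (k - 1) = Finset.Ico 1 k by ext; simp; omega,
      Finset.sum_Ico_eq_sum_range]
    refine Finset.sum_congr rfl fun i _ => ?_
    have e4 : x / k + y / k - (2 * (k : ℝ) - (1 + i : ℕ) + 1) * (x / k * (y / k))
        = u * (x + y - 2 * (x * y) + i * u * (x * y)) := by
      rw [hu]; push_cast; field_simp; ring
    have e5 := negMulLog_mul u (x + y - 2 * (x * y) + i * u * (x * y))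
    rw [hηu] at e5
    rw [e4, ← e5, negMulLog, neg_mul, neg_neg]
  rw [g, e1, e1, e2, e3, negMulLog, negMulLog]
  ring

theorem typeIII_prod {φ x : ℝ} (f : ℝ × ℝ → ℝ) (hp : 0 ≤ (φ - x) / (1 - x))
    (hq : 0 ≤ (1 - φ) / (1 - x)) :
    ∫ z, f z ∂((typeIII φ x).prod (typeIII φ x))
      = ((φ - x) / (1 - x)) ^ 2 * f (1, 1)
        + (φ - x) / (1 - x) * ((1 - φ) / (1 - x)) * (f (1, x) + f (x, 1))
        + ((1 - φ) / (1 - x)) ^ 2 * f (x, x) := by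
  have hi : ∀ (c : ENNReal) (z : ℝ × ℝ), c ≠ ⊤ → Integrable f (c • Measure.dirac z) :=
    fun c z hc => (integrable_dirac (by simp)).smul_measure hc
  rw [typeIII, Measure.prod_add, Measure.add_prod, Measure.add_prod]
  simp only [Measure.prod_smul_left, Measure.prod_smul_right, Measure.dirac_prod_dirac, smul_smul]
  have ht : ∀ a b : ℝ, ENNReal.ofReal a * ENNReal.ofReal b ≠ ⊤ := fun a b =>
    ENNReal.mul_ne_top ENNReal.ofReal_ne_top ENNReal.ofReal_ne_top
  rw [integral_add_measure ((hi _ _ (ht _ _)).add_measure (hi _ _ (ht _ _)))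
    ((hi _ _ (ht _ _)).add_measure (hi _ _ (ht _ _))),
    integral_add_measure (hi _ _ (ht _ _)) (hi _ _ (ht _ _)),
    integral_add_measure (hi _ _ (ht _ _)) (hi _ _ (ht _ _))]
  simp only [integral_smul_measure, integral_dirac, ENNReal.toReal_mul, smul_eq_mul,
    ENNReal.toReal_ofReal hp, ENNReal.toReal_ofReal hq]
  ring

theorem typeIII_integral {φ x : ℝ} (f : ℝ → ℝ) (hp : 0 ≤ (φ - x) / (1 - x))
    (hq : 0 ≤ (1 - φ) / (1 - x)) :
    ∫ z, f z ∂(typeIII φ x)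
      = (φ - x) / (1 - x) * f 1 + (1 - φ) / (1 - x) * f x := by
  have hi : ∀ (a z : ℝ), Integrable f (ENNReal.ofReal a • Measure.dirac z) :=
    fun a z => (integrable_dirac (by simp)).smul_measure ENNReal.ofReal_ne_top
  rw [typeIII, integral_add_measure (hi _ _) (hi _ _)]
  simp only [integral_smul_measure, integral_dirac, smul_eq_mul,
    ENNReal.toReal_ofReal hp, ENNReal.toReal_ofReal hq]

theorem typeIII_mem {φ x : ℝ} (hx0 : 0 ≤ x) (hxφ : x ≤ φ) (hφ : φ < 1) :
    typeIII φ x ∈ M φ := by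
  have h1 : 0 < 1 - x := by linarith
  have hp : 0 ≤ (φ - x) / (1 - x) := div_nonneg (by linarith) h1.le
  have hq : 0 ≤ (1 - φ) / (1 - x) := div_nonneg (by linarith) h1.le
  refine ⟨⟨?_⟩, ?_, ?_⟩
  · simp only [typeIII, Measure.add_apply, Measure.smul_apply, measure_univ, smul_eq_mul, mul_one]
    rw [← ENNReal.ofReal_add hp hq, ← add_div, sub_add_sub_cancel', div_self h1.ne',
      ENNReal.ofReal_one]
  · have a : (1 : ℝ) ∉ (Set.Icc (0 : ℝ) 1)ᶜ := by simp
    have b : x ∉ (Set.Icc (0 : ℝ) 1)ᶜ := by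
      simp only [Set.mem_compl_iff, not_not]; constructor <;> linarith
    simp [typeIII, Measure.dirac_apply' _ measurableSet_Icc.compl, a, b]
  · rw [typeIII_integral _ hp hq]
    field_simp
    ring

theorem sum_affine_mul {k : ℕ} (hk : 1 ≤ k) {u : ℝ} (hu : u = (k : ℝ)⁻¹) (a b c : ℝ) :
    (∑ i ∈ Finset.range (k - 1), (a + i * u * b)) * (u * c)
      = (a * (1 - u) + b * ((1 - u) * (1 - 2 * u) / 2)) * c := by
  have key := riemann_sum_quartic hk hu a b 0 0 0
  have e : ∀ i : ℕ, a + b * (i * u) + 0 * (i * u) ^ 2 + 0 * (i * u) ^ 3 + 0 * (i * u) ^ 4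
      = a + i * u * b := fun i => by ring
  simp only [e] at key
  linear_combination c * key

theorem g_one_left {k m : ℕ} (hk : 1 ≤ k) {u : ℝ} (hu : u = (k : ℝ)⁻¹) (x : ℝ) :
    g k m (1 / k) (x / k) = negMulLog (u + (1 / 2 + u / 2 - u ^ 2) * x)
      + ((1 - x) * (1 - u) + x * ((1 - u) * (1 - 2 * u) / 2)) * log k
      + u * ∑ i ∈ Finset.range (k - 1), negMulLog (1 - x + i * u * x) := by
  have e : ∀ i : ℕ, 1 + x - 2 * (1 * x) + i * u * (1 * x) = 1 - x + i * u * x := fun i => by ring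
  simp only [g_div hk hu, e]
  rw [sum_affine_mul hk hu, show (1 + x) * u + (1 / 2 - u / 2 - u ^ 2) * (1 * x)
    = u + (1 / 2 + u / 2 - u ^ 2) * x by ring]
  simp

theorem g_one_right {k m : ℕ} (hk : 1 ≤ k) {u : ℝ} (hu : u = (k : ℝ)⁻¹) (x : ℝ) :
    g k m (x / k) (1 / k) = g k m (1 / k) (x / k) := by
  simp only [g_div hk hu, mul_comm x 1, add_comm x 1, mul_comm (1 - x) (1 - 1)]

theorem g_one_one {k m : ℕ} (hk : 1 ≤ k) {u : ℝ} (hu : u = (k : ℝ)⁻¹) :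
    g k m (1 / k) (1 / k) = negMulLog (1 / 2 + 3 / 2 * u - u ^ 2)
      + (1 - u) * (1 - 2 * u) / 2 * log k
      + u * ∑ i ∈ Finset.range (k - 1), negMulLog (i * u) := by
  rw [g_one_left hk hu, show u + (1 / 2 + u / 2 - u ^ 2) * 1 = 1 / 2 + 3 / 2 * u - u ^ 2 by ring]
  simp

/-- Every entropy argument except `(1-x)^2` contains a factor `x`, pulled out by `negMulLog_mul`.
The weights of the resulting `negMulLog x` terms add up to `2 - x`. -/
theorem g_diag {k m : ℕ} (hk : 1 ≤ k) {u : ℝ} (hu : u = (k : ℝ)⁻¹) (x : ℝ) :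
    g k m (x / k) (x / k) = 2 * (1 - x) * negMulLog (1 - x) + (2 - x) * negMulLog x
      + x * (negMulLog (2 * u + (1 / 2 - u / 2 - u ^ 2) * x)
        + u * ∑ i ∈ Finset.range (k - 1), negMulLog (2 - 2 * x + i * u * x))
      + x * ((2 - 2 * x) * (1 - u) + x * ((1 - u) * (1 - 2 * u) / 2)) * log k
      + (1 - x) * (1 - x) * log m := by
  have e : ∀ i : ℕ, x + x - 2 * (x * x) + i * u * (x * x) = x * (2 - 2 * x + i * u * x) :=
    fun i => by ring
  have hs : u * ∑ i ∈ Finset.range (k - 1), negMulLog (x * (2 - 2 * x + i * u * x))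
      = ((2 - 2 * x) * (1 - u) + x * ((1 - u) * (1 - 2 * u) / 2)) * negMulLog x
        + x * (u * ∑ i ∈ Finset.range (k - 1), negMulLog (2 - 2 * x + i * u * x)) := by
    simp_rw [negMulLog_mul]
    rw [Finset.sum_add_distrib, ← Finset.mul_sum, ← Finset.sum_mul]
    linear_combination sum_affine_mul hk hu (2 - 2 * x) x (negMulLog x)
  simp only [g_div hk hu, e]
  rw [hs, ← Finset.mul_sum, show (x + x) * u + (1 / 2 - u / 2 - u ^ 2) * (x * x)
    = x * (2 * u + (1 / 2 - u / 2 - u ^ 2) * x) by ring, negMulLog_mul, negMulLog_mul]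
  linear_combination x * sum_affine_mul hk hu (2 - 2 * x) x (log k)

/-! ### The three signs in the decomposition -/

theorem negMulLog_le_two_fifths {t : ℝ} (ht : 0 ≤ t) : negMulLog t ≤ 2 / 5 := by
  have h := negMulLog_le_tangent (s := 2 / 5) (by norm_num) ht
  rw [log_div (by norm_num) (by norm_num)] at h
  nlinarith [log_two_gt_d9, log_five_bounds.2]

theorem log_five_le_log {k : ℕ} (hk : 5 ≤ k) : 1.608 ≤ log k :=
  (by linarith [log_five_bounds.1] : (1.608 : ℝ) ≤ log 5).trans
    (log_le_log (by norm_num) (by exact_mod_cast hk))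

/-- The two entropy contributions total at most `4/5`, while the coefficient of `log k` leaves a
surplus of at least `log k / 2 ≥ 0.804`. -/
theorem g_one_one_le {k m : ℕ} (hk : 5 ≤ k) : g k m (1 / k) (1 / k) ≤ log k := by
  obtain ⟨u, hu⟩ : ∃ u, u = (k : ℝ)⁻¹ := ⟨_, rfl⟩
  have hu0 : 0 ≤ u := by rw [hu]; positivity
  have hu5 : u ≤ 1 / 5 := by
    rw [hu, one_div]
    exact inv_anti₀ (by norm_num) (by exact_mod_cast hk)
  have hsum : u * ∑ i ∈ Finset.range (k - 1), negMulLog (i * u) ≤ 2 / 5 := by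
    have h1 : ∑ i ∈ Finset.range (k - 1), negMulLog (i * u) ≤ k * (2 / 5) := by
      refine (Finset.sum_le_card_nsmul _ _ (2 / 5) fun i _ =>
        negMulLog_le_two_fifths (by positivity)).trans ?_
      rw [Finset.card_range, nsmul_eq_mul]
      have : ((k - 1 : ℕ) : ℝ) ≤ k := by exact_mod_cast Nat.sub_le k 1
      linarith
    refine (mul_le_mul_of_nonneg_left h1 hu0).trans (le_of_eq ?_)
    rw [hu, inv_mul_cancel_left₀ (by positivity)]
  have hB := negMulLog_le_two_fifths (t := 1 / 2 + 3 / 2 * u - u ^ 2) (by nlinarith)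
  have hL := log_five_le_log hk
  rw [g_one_one (by omega) hu]
  nlinarith [mul_nonneg hu0 (show 0 ≤ log k by linarith),
    mul_le_mul_of_nonneg_right hu5 (mul_nonneg hu0 (show 0 ≤ log k by linarith))]

section

variable {k m : ℕ} {x : ℝ}

/-- The explicit factor `x` allows the difference to vanish at `x = 0` and gives strict positivity
for `x > 0`. -/
theorem g_diag_sub_h_lower (hk : 5 ≤ k) (hx0 : 0 ≤ x) (hx : x ≤ 1 / 2)
    (hl : log m ≤ log k / 2) (hl5 : k = 5 → log m ≤ log 2) :
    ∃ c > 0, x * c ≤ g k m (x / k) (x / k) - h k m (x / k) := by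
  refine ⟨_, single_point_pos hk rfl hx0 hx hl hl5, ?_⟩
  rw [g_diag (by omega) rfl, h_div (by omega)]
  have h1 := negMulLog_one_sub_ge hx0 (by linarith)
  have h1' : (1 - x) * x ≤ negMulLog (1 - x) := by nlinarith [sq_nonneg x]
  have h2 := negMulLog_ge_of_le_half hx0 hx
  have h2' : x * (log 2 + 1 - 2 * x) ≤ negMulLog x := by
    nlinarith [mul_nonneg hx0 (sq_nonneg (1 - 2 * x))]
  have h3 := mul_le_mul_of_nonneg_left h1' (show 0 ≤ 1 - 2 * x by linarith)
  have h4 := mul_le_mul_of_nonneg_left h2' (show 0 ≤ 1 - x by linarith)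
  linarith

/-- At mean `1/2` the weights are in ratio `(1-2x) : 1`; this is the homogenised form there. The
`negMulLog (1-x)` terms cancel, and only `x * negMulLog x` survives of the `negMulLog x` terms. -/
theorem quadratic_at_half_pos (hk : 5 ≤ k) (hx0 : 0 ≤ x) (hx : x ≤ 1 / 2)
    (hl : log m ≤ log k / 2) (hl5 : k = 5 → log m ≤ log 2) :
    0 < (1 - 2 * x) ^ 2 * (g k m (1 / k) (1 / k) - log k)
      + (1 - 2 * x) * (2 * g k m (1 / k) (x / k) - log k - h k m (x / k))
      + (g k m (x / k) (x / k) - h k m (x / k)) := by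
  refine (half_mean_pos hk rfl hx0 hx hl hl5).trans_eq ?_
  rw [g_one_one (by omega) rfl, g_one_left (by omega) rfl x, g_diag (by omega) rfl x,
    h_div (by omega) x]
  ring

theorem F_typeIII {φ : ℝ} (hk : 1 ≤ k) (hp : 0 ≤ (φ - x) / (1 - x))
    (hq : 0 ≤ (1 - φ) / (1 - x)) :
    F k m (typeIII φ x)
      = ((φ - x) / (1 - x)) ^ 2 * g k m (1 / k) (1 / k)
        + (φ - x) / (1 - x) * ((1 - φ) / (1 - x)) * (2 * g k m (1 / k) (x / k))
        + ((1 - φ) / (1 - x)) ^ 2 * g k m (x / k) (x / k)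
        - (φ - x) / (1 - x) * log k - (1 - φ) / (1 - x) * h k m (x / k) := by
  have h1 : h k m (1 / k) = log k := by rw [h_div hk]; simp
  rw [F, typeIII_prod _ hp hq, typeIII_integral _ hp hq]
  simp only [g_one_right hk rfl, h1]
  ring

end

/-! ### Bounds on `log m` and conclusion -/

theorem log_le_half_log_of_le_sqrt {k m : ℕ} (hm : 1 ≤ m) (hmk : (m : ℝ) ≤ √k) :
    log m ≤ log k / 2 := by
  rw [← log_sqrt (by positivity)]
  exact log_le_log (by exact_mod_cast hm) hmk

theorem log_le_log_two_of_le_sqrt_five {m : ℕ} (hm : 1 ≤ m) (hmk : (m : ℝ) ≤ √(5 : ℕ)) :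
    log m ≤ log 2 := by
  refine log_le_log (by exact_mod_cast hm) ?_
  have h1 : (m : ℝ) ^ 2 ≤ 5 := by
    have := (le_sqrt (by positivity) (by positivity)).1 hmk
    exact_mod_cast this
  have h2 : m ^ 2 ≤ 5 := by exact_mod_cast h1
  have : m ≤ 2 := by nlinarith
  exact_mod_cast this

end EntropyFunctional


theorem mainTheorem11 (k m : ℕ) (hk : 5 ≤ k) (hm : 1 ≤ m) (hmk : (m : ℝ) ≤ Real.sqrt k)
    (φ x : ℝ) (hφ0 : 0 < φ) (hφ : φ < 1 / 2) (hx : x ∈ Set.Icc 0 φ) :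
    EntropyFunctional.typeIII φ x ∈ EntropyFunctional.M φ ∧
      0 < EntropyFunctional.F k m (EntropyFunctional.typeIII φ x) := by
  obtain ⟨hx0, hxφ⟩ := hx
  refine ⟨EntropyFunctional.typeIII_mem hx0 hxφ (by linarith), ?_⟩
  have h1 : 0 < 1 - x := by linarith
  have hp : 0 ≤ (φ - x) / (1 - x) := div_nonneg (by linarith) h1.le
  have hq : 0 < (1 - φ) / (1 - x) := div_pos (by linarith) h1
  have hpq : (φ - x) / (1 - x) + (1 - φ) / (1 - x) = 1 := by field_simp; ring
  have hgap : (1 - φ) / (1 - x) * (1 - 2 * x) - (φ - x) / (1 - x) = 1 - 2 * φ := by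
    field_simp; ring
  have hl := EntropyFunctional.log_le_half_log_of_le_sqrt hm hmk
  have hl5 : k = 5 → Real.log m ≤ Real.log 2 := by
    rintro rfl
    exact EntropyFunctional.log_le_log_two_of_le_sqrt_five hm hmk
  have hE := EntropyFunctional.quadratic_at_half_pos hk hx0 (by linarith) hl hl5
  obtain ⟨c, hc, hD⟩ := EntropyFunctional.g_diag_sub_h_lower hk hx0 (by linarith) hl hl5
  have hN := EntropyFunctional.g_one_one_le (m := m) hk
  rw [EntropyFunctional.F_typeIII (by omega) hp hq.le]
  -- If the atom at `1` disappears, then `x = φ > 0`, so the diagonal term alone is strictly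
  -- positive.
  have hp0 : (φ - x) / (1 - x) = 0 → 0 < x := by
    intro h
    rcases div_eq_zero_iff.1 h with h | h <;> linarith
  generalize (φ - x) / (1 - x) = p at *
  generalize (1 - φ) / (1 - x) = q at *
  generalize EntropyFunctional.g k m (1 / k) (1 / k) = g₁ at *
  generalize EntropyFunctional.g k m (1 / k) (x / k) = g₂ at *
  generalize EntropyFunctional.g k m (x / k) (x / k) = g₃ at *
  generalize EntropyFunctional.h k m (x / k) = h₃ at *
  generalize Real.log k = L at *
  have hρ : 0 < 1 - 2 * x := by linarith
  have hpq' : p = 1 - q := by linarith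
  have hφ' : φ = (1 - (q * (1 - 2 * x) - p)) / 2 := by linarith
  have hD0 : 0 ≤ g₃ - h₃ := (mul_nonneg hx0 hc.le).trans hD
  refine pos_of_mul_pos_right (a := 1 - 2 * x) ?_ hρ.le
  -- The splitting around mean `1/2`; it is a polynomial identity once `p` and `φ` are expressed
  -- through `q` and `x`.
  have hid : (1 - 2 * x) * (p ^ 2 * g₁ + p * q * (2 * g₂) + q ^ 2 * g₃ - p * L - q * h₃)
      = p * q * ((1 - 2 * x) ^ 2 * (g₁ - L) + (1 - 2 * x) * (2 * g₂ - L - h₃) + (g₃ - h₃))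
        + (1 - 2 * φ) * (p * (1 - 2 * x) * (L - g₁) + q * (g₃ - h₃)) := by
    rw [hφ', hpq']; ring
  rw [hid]
  have hgap0 : 0 < 1 - 2 * φ := by linarith
  have hN' : 0 ≤ p * (1 - 2 * x) * (L - g₁) := mul_nonneg (mul_nonneg hp hρ.le) (by linarith)
  rcases hp.eq_or_lt with hp | hp
  · have hD' : 0 < g₃ - h₃ := (mul_pos (hp0 hp.symm) hc).trans_le hD
    rw [← hp]
    simp only [zero_mul, zero_add]
    exact mul_pos hgap0 (mul_pos hq hD')
  · exact add_pos_of_pos_of_nonneg (mul_pos (mul_pos hp hq) hE)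
      (mul_nonneg hgap0.le (add_nonneg hN' (mul_nonneg hq.le hD0)))
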